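/- **Notation.** Let $x_0,x_1,x_2,\dots$ be commuting variables, $[n]=\{1,\dots,n\}$ and $[0,n-1]=\{0,\dots,n-1\}$. For $I\subseteq[0,n-1]$ let \[F^B_I=\sum_{\substack{0=i_0\le i_1\le\cdots\le i_n\\ j\in I\Rightarrow i_j<i_{j+1}}}x_{i_1}\cdots x_{i_n},\qquad \mathrm{Peak}^B(I)=\{p\in[n-1]:p\in I,\ p-1\notin I\},\] and, with $P=\mathrm{Peak}^B(I)$, $J+1=\{j+1:j\in J\}$ and $\triangle$ the symmetric difference, let $\Delta^B(I)$ be the type-$B$ peak function \[\Delta^B(I)=\begin{cases}K_{(0,P)}=2^{|P|}\displaystyle\sum_{J\subseteq[0,n-1],\ P\subseteq J\triangle(J+1)}F^B_J&\text{if }0\notin I,\\[2ex] K_{(1,P)}=2^{|P|+1}\displaystyle\sum_{0\in J\subseteq[0,n-1],\ P\subseteq J\triangle(J+1)}F^B_J&\text{if }0\in I.\end{cases}\] (These depend on $n$.) The *$2$-quotient* $(\mu,\nu)$ of a partition $\lambda=(\lambda_1,\dots,\lambda_k)$ is obtained as follows. Let $\lambda^\star=(\lambda_i+k-i)_{1\le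 i\le k}$. From the even (respectively, odd) entries of $\lambda^\star$, read from right to left, subtract $0,2,4,\dots$ (respectively, $1,3,5,\dots$); divide the results by $2$ and remove zeros. The even entries give $\mu=(\mu_1,\dots,\mu_p)$, and the odd entries give $\nu=(\nu_1,\dots,\nu_q)$. A domino of a domino tiling of the Young diagram of $\lambda$ is *strictly below* the main diagonal if all its cells are, and *weakly above* it otherwise. A domino tiling of $\lambda$ is *shifted* if there is no vertical domino $d$ meeting the main diagonal such that there is at least one domino left of and adjacent to $d$ and all such dominoes are strictly below the main diagonal. A *semistandard shifted domino tableau* of shape $\lambda$ is a filling of the dominoes weakly above the main diagonal in a shifted tiling of $\lambda$ with entries from $\{0<1'<1<2'<2<\cdots\}$ such that entries weakly increase from left to right along rows and from top to bottom in columns; for each $i\ge1$, each row contains at most one $i'$; for each $i\geq 0$, each column contains at most one $i$; and the northwest-most domino may be filled with $0$ only if it is horizontal. Let $\mathsf{SSShDT}(\lambda)$ be the set of these, and for such a $T$ let $x^{\mathrm{wt}(T)}=\prod_i x_i^{\mathrm{wt}_i(T)}$, where $\mathrm{wt}_i(T)$ is the number of entries of $T$ equal to $i$ or $i'$. The *shifted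 domino function* is $H_\lambda=\sum_{T\in\mathsf{SSShDT}(\lambda)}x^{\mathrm{wt}(T)}$. A *standard shifted domino tableau* of shape $\lambda$ is a bijective filling of the dominoes weakly above the main diagonal in a shifted tiling of $\lambda$ with entries in $[m]$, where $m$ is the number of these dominoes, such that entries strictly increase from left to right along rows and from top to bottom in columns. Let $\mathsf{SShDT}(\lambda)$ be the set of these. (Tableaux, standard or semistandard, are identified when they have the same filled dominoes with the same entries.) For $Q\in\mathsf{SShDT}(\lambda)$, the set $\mathrm{Des}(Q)\subseteq[0,m-1]$ contains $0$ if and only if $m\ge1$ and the domino with entry $1$ is vertical; it contains $i\in[m-1]$ if and only if the domino with entry $i+1$ is strictly lower than the domino with entry $i$ (each cell of the former is in a lower row than each cell of the latter). **Corollary.** Let $\lambda$ be a partition whose $2$-quotient $(\mu,\nu)=((\mu_1,\dots,\mu_p),(\nu_1,\dots,\nu_q))$ satisfies $\mu_p\ge p$ (if $p\geq 1$) and $\nu_q\ge q$ (if $q\geq 1$). Then \[H_\lambda=\sum_{Q\in\mathsf{SShDT}(\lambda)}\Delta^B(\mathrm{Des}(Q)),\] where $\Delta^B(\mathrm{Des}(Q))$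 is taken with $n$ equal to the number $m$ of dominoes of $Q$. -/

import Mathlib

namespace ShiftedDomino

/-! ### Generating functions in the variables `x_0, x_1, x_2, …` -/

/-- The formal power series `∑_{a : α} x^{wt a}`: the coefficient of `x^e` is the number of `a`
with `wt a = e`. It is used only for families in which each of these numbers is finite. -/
noncomputable def genFun {α : Type} (wt : α → (ℕ →₀ ℕ)) : MvPowerSeries ℕ ℤ :=
  fun e => (Nat.card {a : α // wt a = e} : ℤ)

/-! ### Type-`B` fundamental quasisymmetric functions and peak functions -/

/-- Sequences `0 = i_0 ≤ i_1 ≤ ⋯ ≤ i_n` with `i_j < i_{j+1}` whenever `j ∈ I`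
(only the elements of `I` in `[0, n-1]` matter). -/
def FundSeq (n : ℕ) (I : Finset ℕ) : Type :=
  {i : Fin (n + 1) → ℕ //
    i 0 = 0 ∧ Monotone i ∧ ∀ j : Fin n, (j : ℕ) ∈ I → i j.castSucc < i j.succ}

/-- The exponent of the monomial `x_{i_1} x_{i_2} ⋯ x_{i_n}`. -/
noncomputable def FundSeq.wt {n : ℕ} {I : Finset ℕ} (i : FundSeq n I) : ℕ →₀ ℕ :=
  ∑ j : Fin n, Finsupp.single (i.1 j.succ) 1

theorem FundSeq.finite_wt_eq (n : ℕ) (I : Finset ℕ) (e : ℕ →₀ ℕ) :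
    Finite {i : FundSeq n I // i.wt = e} := by
  have key : ∀ a : {i : FundSeq n I // i.wt = e}, ∀ j : Fin n, a.1.1 j.succ ∈ e.support := by
    rintro ⟨a, rfl⟩ j
    unfold FundSeq.wt
    rw [Finsupp.mem_support_iff, Finsupp.finsetSum_apply]
    refine ne_of_gt (Finset.sum_pos' (fun _ _ => Nat.zero_le _) ⟨j, Finset.mem_univ _, ?_⟩)
    simp
  refine Finite.of_injective
    (fun a : {i : FundSeq n I // i.wt = e} =>
      fun j : Fin n => (⟨a.1.1 j.succ, key a j⟩ : e.support)) ?_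
  intro a b h
  apply Subtype.ext
  apply Subtype.ext
  funext k
  refine Fin.cases ?_ (fun j => ?_) k
  · rw [a.1.2.1, b.1.2.1]
  · exact congrArg Subtype.val (congrFun h j)

/-- The type-`B` fundamental quasisymmetric function `F^B_I` of degree `n`. -/
noncomputable def fundB (n : ℕ) (I : Finset ℕ) : MvPowerSeries ℕ ℤ :=
  genFun (FundSeq.wt : FundSeq n I → (ℕ →₀ ℕ))

/-- `P ⊆ J △ (J + 1)`. -/
def PeakCompatible (P J : Finset ℕ) : Prop :=
  P ⊆ symmDiff J (J.image (· + 1))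

open Classical in
/-- The type-`B` peak function `K_{(0,P)}` of degree `n`. -/
noncomputable def peakFun0 (n : ℕ) (P : Finset ℕ) : MvPowerSeries ℕ ℤ :=
  2 ^ P.card * ∑ J ∈ (Finset.range n).powerset with PeakCompatible P J, fundB n J

open Classical in
/-- The type-`B` peak function `K_{(1,P)}` of degree `n` (meant for `1 ∉ P`). -/
noncomputable def peakFun1 (n : ℕ) (P : Finset ℕ) : MvPowerSeries ℕ ℤ :=
  2 ^ (P.card + 1) *
    ∑ J ∈ (Finset.range n).powerset with (0 ∈ J ∧ PeakCompatible P J), fundB n J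

/-- The type-`B` peak set `{p ∈ [n-1] : p ∈ I, p - 1 ∉ I}`. -/
def peakSetB (n : ℕ) (I : Finset ℕ) : Finset ℕ :=
  {p ∈ Finset.Icc 1 (n - 1) | p ∈ I ∧ p - 1 ∉ I}

/-- `Δ^B(I)` in degree `n`. If `0 ∈ I`, then `1` is not in the peak set of `I`. -/
noncomputable def deltaB (n : ℕ) (I : Finset ℕ) : MvPowerSeries ℕ ℤ :=
  if 0 ∈ I then peakFun1 n (peakSetB n I) else peakFun0 n (peakSetB n I)

/-! ### The 2-quotient of a partition -/

/-- `λ^⋆`: with `k` the number of parts, `k - i` is added to the `i`-th part (`i = 1, …, k`). -/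
def starParts (l : List ℕ) : List ℕ :=
  l.mapIdx fun i x => x + (l.length - (i + 1))

/-- Given a strictly decreasing list of numbers of parity `r ∈ {0, 1}`, subtract
`r, r + 2, r + 4, …` from right to left, halve the results, and remove the zeros. -/
def quotientParts (r : ℕ) (l : List ℕ) : List ℕ :=
  (l.mapIdx fun i x => (x - (2 * (l.length - (i + 1)) + r)) / 2).filter (· ≠ 0)

/-- The 2-quotient `(μ, ν)` of the partition with the given list of parts, in weakly decreasing
order; `μ` comes from the even entries of `λ^⋆` and `ν` from the odd ones. -/
def twoQuotient (l : List ℕ) : List ℕ × List ℕ :=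
  (quotientParts 0 ((starParts l).filter (· % 2 = 0)),
    quotientParts 1 ((starParts l).filter (· % 2 = 1)))

/-- The last (smallest) part, if there is one, is at least the number of parts. -/
def LastPartLarge (l : List ℕ) : Prop :=
  ∀ x ∈ l.getLast?, l.length ≤ x

/-- The 2-quotient `((μ_1, …, μ_p), (ν_1, …, ν_q))` of `lam` satisfies `μ_p ≥ p` and
`ν_q ≥ q`. -/
def QuotientCondition (lam : YoungDiagram) : Prop :=
  LastPartLarge (twoQuotient lam.rowLens).1 ∧ LastPartLarge (twoQuotient lam.rowLens).2

/-! ### Dominoes and shifted tilings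

A cell is a pair `(row, column)`, rows being numbered from top to bottom and columns from left to
right, as in `YoungDiagram`. The main diagonal consists of the cells `(i, i)`. -/

/-- A set of cells; the dominoes are those satisfying `IsDomino`. -/
abbrev Cells : Type := Finset (ℕ × ℕ)

def IsHorizontal (d : Cells) : Prop := ∃ i j : ℕ, d = {(i, j), (i, j + 1)}

def IsVertical (d : Cells) : Prop := ∃ i j : ℕ, d = {(i, j), (i + 1, j)}

def IsDomino (d : Cells) : Prop := IsHorizontal d ∨ IsVertical d

/-- `t` is a set of dominoes that tiles the Young diagram `lam`. -/
def IsDominoTiling (lam : YoungDiagram) (t : Finset Cells) : Prop :=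
  (∀ d ∈ t, IsDomino d) ∧ (t : Set Cells).PairwiseDisjoint id ∧ t.biUnion id = lam.cells

/-- The domino meets the main diagonal. -/
def OnDiagonal (d : Cells) : Prop := ∃ c ∈ d, c.1 = c.2

/-- All cells of the domino are strictly below the main diagonal. -/
def StrictlyBelowDiagonal (d : Cells) : Prop := ∀ c ∈ d, c.2 < c.1

/-- The domino is not strictly below the main diagonal: it meets the diagonal or lies above. -/
def WeaklyAboveDiagonal (d : Cells) : Prop := ∃ c ∈ d, c.1 ≤ c.2

/-- `e ≠ d` has a cell immediately to the left of a cell of `d`. -/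
def LeftAdjacent (e d : Cells) : Prop := e ≠ d ∧ ∃ c ∈ e, (c.1, c.2 + 1) ∈ d

/-- Shifted tilings: no vertical domino `d` on the main diagonal has the property that the
dominoes left of `d` and adjacent to `d` (there being at least one) are all strictly below the
main diagonal. A vertical domino covering the two top cells of the first column is allowed. -/
def IsShiftedTiling (lam : YoungDiagram) (t : Finset Cells) : Prop :=
  IsDominoTiling lam t ∧
    ¬ ∃ d ∈ t, IsVertical d ∧ OnDiagonal d ∧ (∃ e ∈ t, LeftAdjacent e d) ∧
      ∀ e ∈ t, LeftAdjacent e d → StrictlyBelowDiagonal e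

open Classical in
/-- The set of dominoes of `t` weakly above the main diagonal. -/
noncomputable def upperDominoes (t : Finset Cells) : Finset Cells :=
  {d ∈ t | WeaklyAboveDiagonal d}

/-- `s` is the set of dominoes weakly above the main diagonal of a shifted tiling of `lam`. -/
def IsUpperPart (lam : YoungDiagram) (s : Finset Cells) : Prop :=
  ∃ t : Finset Cells, IsShiftedTiling lam t ∧ upperDominoes t = s

/-- Some cell of `d` is in the same row as, and to the left of, some cell of `e`. -/
def LeftInRow (d e : Cells) : Prop := ∃ c ∈ d, ∃ c' ∈ e, c.1 = c'.1 ∧ c.2 < c'.2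

/-- Some cell of `d` is in the same column as, and above, some cell of `e`. -/
def AboveInColumn (d e : Cells) : Prop := ∃ c ∈ d, ∃ c' ∈ e, c.2 = c'.2 ∧ c.1 < c'.1

def ShareRow (d e : Cells) : Prop := ∃ c ∈ d, ∃ c' ∈ e, c.1 = c'.1

def ShareColumn (d e : Cells) : Prop := ∃ c ∈ d, ∃ c' ∈ e, c.2 = c'.2

/-- `e` is strictly lower than `d`: each cell of `e` is in a lower row than each cell of `d`. -/
def StrictlyLower (e d : Cells) : Prop := ∀ c ∈ d, ∀ c' ∈ e, c.1 < c'.1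

/-! ### The alphabet `0 < 1' < 1 < 2' < 2 < ⋯` -/

/-- `unprimed k` is the letter `k` (for `k ≥ 0`), and `primed k` is the letter `k'`
(for `k ≥ 1`). -/
inductive Letter : Type
  | unprimed (k : ℕ) : Letter
  | primed (k : ℕ+) : Letter

namespace Letter

/-- The position in the ordered alphabet, starting from `0`. -/
def rank : Letter → ℕ
  | unprimed k => 2 * k
  | primed k => 2 * (k : ℕ) - 1

theorem rank_injective : Function.Injective rank := by
  rintro (a | a) (b | b) h
  · simp only [rank] at h
    exact congrArg _ (by omega)
  · have := b.pos
    simp only [rank] at h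
    omega
  · have := a.pos
    simp only [rank] at h
    omega
  · have := a.pos
    have := b.pos
    simp only [rank] at h
    exact congrArg _ (PNat.coe_injective (by omega))

noncomputable instance : LinearOrder Letter := LinearOrder.lift' rank rank_injective

/-- The letter without its prime. -/
def abs : Letter → ℕ
  | unprimed k => k
  | primed k => k

theorem finite_abs_mem (s : Finset ℕ) : Finite {x : Letter // x.abs ∈ s} := by
  have h : ∀ x : {x : Letter // x.abs ∈ s}, x.1.rank < 2 * s.sup id + 1 := by
    rintro ⟨x, hx⟩
    have := Finset.le_sup (f := id) hx
    cases x <;> simp only [rank, abs, id] at * <;> omega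
  refine Finite.of_injective
    (fun x : {x : Letter // x.abs ∈ s} => (⟨x.1.rank, h x⟩ : Fin (2 * s.sup id + 1))) ?_
  intro x y hxy
  exact Subtype.ext (rank_injective (congrArg Fin.val hxy))

end Letter

/-! ### Semistandard shifted domino tableaux -/

/-- Semistandard shifted domino tableaux of shape `lam`: fillings of the dominoes weakly above
the main diagonal in a shifted tiling of `lam`. -/
structure SSShDT (lam : YoungDiagram) : Type where
  dominoes : Finset Cells
  isUpperPart : IsUpperPart lam dominoes
  entry : {d // d ∈ dominoes} → Letter
  row_weak : ∀ d e : {d // d ∈ dominoes}, LeftInRow d.1 e.1 → entry d ≤ entry e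
  column_weak : ∀ d e : {d // d ∈ dominoes}, AboveInColumn d.1 e.1 → entry d ≤ entry e
  /-- Each row contains at most one `k'`. -/
  row_primed : ∀ (k : ℕ+) (d e : {d // d ∈ dominoes}), ShareRow d.1 e.1 →
    entry d = Letter.primed k → entry e = Letter.primed k → d = e
  /-- Each column contains at most one `k`, including `k = 0`. -/
  column_unprimed : ∀ (k : ℕ) (d e : {d // d ∈ dominoes}), ShareColumn d.1 e.1 →
    entry d = Letter.unprimed k → entry e = Letter.unprimed k → d = e
  /-- The northwest-most domino may be filled with `0` only if it is horizontal. -/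
  northwest_zero : ∀ d : {d // d ∈ dominoes}, (0, 0) ∈ d.1 →
    entry d = Letter.unprimed 0 → IsHorizontal d.1

/-- The weight: `wt_k` is the number of entries equal to `k` or `k'`. -/
noncomputable def SSShDT.wt {lam : YoungDiagram} (T : SSShDT lam) : ℕ →₀ ℕ :=
  ∑ d : {d // d ∈ T.dominoes}, Finsupp.single (T.entry d).abs 1

theorem IsUpperPart.mem_powerset {lam : YoungDiagram} {s : Finset Cells}
    (h : IsUpperPart lam s) : s ∈ lam.cells.powerset.powerset := by
  classical
  obtain ⟨t, ht, rfl⟩ := h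
  rw [Finset.mem_powerset]
  intro d hd
  rw [Finset.mem_powerset, ← ht.1.2.2]
  exact Finset.subset_biUnion_of_mem id (Finset.mem_of_mem_filter d hd)

theorem SSShDT.finite_wt_eq (lam : YoungDiagram) (e : ℕ →₀ ℕ) :
    Finite {T : SSShDT lam // T.wt = e} := by
  have key : ∀ T : {T : SSShDT lam // T.wt = e}, ∀ d : {d // d ∈ T.1.dominoes},
      (T.1.entry d).abs ∈ e.support := by
    rintro ⟨T, rfl⟩ d
    unfold SSShDT.wt
    rw [Finsupp.mem_support_iff, Finsupp.finsetSum_apply]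
    refine ne_of_gt (Finset.sum_pos' (fun _ _ => Nat.zero_le _) ⟨d, Finset.mem_univ _, ?_⟩)
    simp
  have := Letter.finite_abs_mem e.support
  refine Finite.of_injective
    (fun T : {T : SSShDT lam // T.wt = e} =>
      (⟨⟨T.1.dominoes, T.1.isUpperPart.mem_powerset⟩,
        fun d => ⟨T.1.entry d, key T d⟩⟩ :
        (s : {s // s ∈ lam.cells.powerset.powerset}) ×
          ({d // d ∈ s.1} → {x : Letter // x.abs ∈ e.support}))) ?_
  rintro ⟨⟨s, hs, f, h1, h2, h3, h4, h5⟩, hT⟩ ⟨⟨s', hs', f', h1', h2', h3', h4', h5'⟩, hT'⟩ h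
  simp only [Sigma.mk.injEq, Subtype.mk.injEq] at h
  obtain ⟨rfl, h⟩ := h
  have hf : f = f' := by
    funext d
    exact congrArg Subtype.val (congrFun (eq_of_heq h) d)
  subst hf
  rfl

/-- The shifted domino function `H_lam = ∑_T x^{wt T}`. -/
noncomputable def shiftedDominoFun (lam : YoungDiagram) : MvPowerSeries ℕ ℤ :=
  genFun (SSShDT.wt : SSShDT lam → (ℕ →₀ ℕ))

/-! ### Standard shifted domino tableaux -/

/-- Standard shifted domino tableaux of shape `lam`: bijective fillings of the `m` dominoes
weakly above the main diagonal in a shifted tiling of `lam` with the numbers `1, …, m`. -/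
structure SShDT (lam : YoungDiagram) : Type where
  dominoes : Finset Cells
  isUpperPart : IsUpperPart lam dominoes
  entry : {d // d ∈ dominoes} → ℕ
  injective : Function.Injective entry
  range_eq : Set.range entry = Set.Icc 1 dominoes.card
  row_strict : ∀ d e : {d // d ∈ dominoes}, d ≠ e → LeftInRow d.1 e.1 → entry d < entry e
  column_strict : ∀ d e : {d // d ∈ dominoes}, d ≠ e → AboveInColumn d.1 e.1 → entry d < entry e

namespace SShDT

variable {lam : YoungDiagram}

/-- The number `m` of dominoes weakly above the main diagonal. -/
def size (Q : SShDT lam) : ℕ := Q.dominoes.card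

/-- `i ∈ [0, m-1]` is a descent if `i = 0` and the domino with entry `1` is vertical, or if
`i > 0` and the domino with entry `i + 1` is strictly lower than the domino with entry `i`. -/
def IsDescent (Q : SShDT lam) (i : ℕ) : Prop :=
  (i = 0 ∧ ∃ d, Q.entry d = 1 ∧ IsVertical d.1) ∨
    (0 < i ∧ ∃ d e, Q.entry d = i ∧ Q.entry e = i + 1 ∧ StrictlyLower e.1 d.1)

open Classical in
/-- The descent set. -/
noncomputable def des (Q : SShDT lam) : Finset ℕ :=
  {i ∈ Finset.range Q.size | Q.IsDescent i}

instance finite (lam : YoungDiagram) : Finite (SShDT lam) := by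
  have key : ∀ Q : SShDT lam, ∀ d : {d // d ∈ Q.dominoes},
      Q.entry d < Q.dominoes.card + 1 := by
    intro Q d
    have h : Q.entry d ∈ Set.Icc 1 Q.dominoes.card := by
      rw [← Q.range_eq]
      exact Set.mem_range_self d
    exact Nat.lt_succ_of_le h.2
  refine Finite.of_injective
    (fun Q : SShDT lam =>
      (⟨⟨Q.dominoes, Q.isUpperPart.mem_powerset⟩, fun d => ⟨Q.entry d, key Q d⟩⟩ :
        (s : {s // s ∈ lam.cells.powerset.powerset}) ×
          ({d // d ∈ s.1} → Fin (s.1.card + 1)))) ?_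
  rintro ⟨s, hs, f, h1, h2, h3, h4⟩ ⟨s', hs', f', h1', h2', h3', h4'⟩ h
  simp only [Sigma.mk.injEq, Subtype.mk.injEq] at h
  obtain ⟨rfl, h⟩ := h
  have hf : f = f' := by
    funext d
    exact congrArg Fin.val (congrFun (eq_of_heq h) d)
  subst hf
  rfl

noncomputable instance fintype (lam : YoungDiagram) : Fintype (SShDT lam) := Fintype.ofFinite _

end SShDT

end ShiftedDomino

/-!
Standardization: sort the dominoes of a semistandard tableau by their letters, reading equal
unprimed letters from left to right and equal primed letters from top to bottom. This turns the
tableau into a standard tableau `Q` together with the sequence of its letters. The sequences that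
occur are those in which equal consecutive letters are primed exactly at the descents of `Q`, so
that the generating function of the tableaux standardizing to `Q` depends only on `Des(Q)`.

This generating function is the peak function of `I = Des(Q)`. Both are graded by the weakly
increasing sequence `i` of absolute values, with set `S` of strict steps. The primed positions over
`i` range over the interval from `I \ S` to `(I ∪ S) + 1`. On the other side, `P` (together with `0`
if `0 ∈ I`) is the set of starts of the maximal runs of consecutive elements of `I`, and one counts
the `J ⊆ S` such that `J △ (J + 1)` contains all these starts. With the power of `2`, both numbers
are `2 ^ |S|` if every start lies in `S ∪ (S + 1)`, and otherwise both are `0`.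
-/

namespace ShiftedDomino

/-! ### Generating functions -/

theorem genFun_congr {α β : Type} {w : α → ℕ →₀ ℕ} {w' : β → ℕ →₀ ℕ} (f : α ≃ β)
    (hf : ∀ a, w' (f a) = w a) : genFun w' = genFun w := by
  funext e
  exact congrArg Nat.cast (Nat.card_congr (f.subtypeEquiv fun a => by rw [hf])).symm

theorem genFun_sigma {ι : Type} [Fintype ι] {α : ι → Type} (w : ∀ i, α i → ℕ →₀ ℕ)
    (hw : ∀ i e, Finite {a // w i a = e}) :
    genFun (fun x : Σ i, α i => w x.1 x.2) = ∑ i, genFun (w i) := by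
  funext e
  have regroup : {x : Σ i, α i // w x.1 x.2 = e} ≃ Σ i, {a // w i a = e} :=
    { toFun := fun x => ⟨x.1.1, x.1.2, x.2⟩
      invFun := fun x => ⟨⟨x.1, x.2.1⟩, x.2.2⟩ }
  calc (Nat.card {x : Σ i, α i // w x.1 x.2 = e} : ℤ)
      = ∑ i, (Nat.card {a // w i a = e} : ℤ) := by
        rw [Nat.card_congr regroup, Nat.card_sigma, Nat.cast_sum]
    _ = (∑ i, genFun (w i)) e := (Finset.sum_apply e Finset.univ fun i => genFun (w i)).symm

/-! ### Peak functions and counting -/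

/-- The elements of `I` at which a maximal run of consecutive integers in `I` starts. For
`I ⊆ [0, n-1]` they are the elements of `Peak^B(I)`, together with `0` if `0 ∈ I`. -/
def runStarts (I : Finset ℕ) : Finset ℕ := I \ I.image (· + 1)

theorem mem_image_succ {J : Finset ℕ} {k : ℕ} : k + 1 ∈ J.image (· + 1) ↔ k ∈ J := by
  simp only [Finset.mem_image, Nat.add_right_cancel_iff, exists_eq_right]

theorem zero_notMem_image_succ (J : Finset ℕ) : 0 ∉ J.image (· + 1) := by
  simp only [Finset.mem_image, Nat.add_eq_zero_iff, one_ne_zero, and_false, exists_false,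
    not_false_eq_true]

theorem succ_notMem_runStarts {I : Finset ℕ} {p : ℕ} (hp : p ∈ runStarts I) :
    p + 1 ∉ runStarts I := fun h =>
  (Finset.mem_sdiff.1 h).2 (mem_image_succ.2 (Finset.mem_sdiff.1 hp).1)

theorem peakSetB_eq {n : ℕ} {I : Finset ℕ} (hI : I ⊆ Finset.range n) :
    peakSetB n I = (runStarts I).erase 0 := by
  ext p
  rcases p with _ | k
  · simp [peakSetB]
  · have := @hI (k + 1)
    simp only [peakSetB, runStarts, Finset.mem_filter, Finset.mem_Icc, Finset.mem_erase,
      Finset.mem_sdiff, mem_image_succ, Finset.mem_range] at this ⊢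
    grind

theorem peakCompatible_insert {P J : Finset ℕ} {q : ℕ} :
    PeakCompatible (insert q P) J ↔ q ∈ symmDiff J (J.image (· + 1)) ∧ PeakCompatible P J :=
  Finset.insert_subset_iff

theorem zero_mem_symmDiff_image_succ {J : Finset ℕ} :
    0 ∈ symmDiff J (J.image (· + 1)) ↔ 0 ∈ J := by
  simp only [Finset.mem_symmDiff, zero_notMem_image_succ, not_false_eq_true, and_true, false_and,
    or_false]

open Classical in
theorem deltaB_eq {n : ℕ} {I : Finset ℕ} (hI : I ⊆ Finset.range n) :
    deltaB n I = 2 ^ (runStarts I).card *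
      ∑ J ∈ (Finset.range n).powerset with PeakCompatible (runStarts I) J, fundB n J := by
  have zero_mem : 0 ∈ runStarts I ↔ 0 ∈ I := by
    simp only [runStarts, Finset.mem_sdiff, zero_notMem_image_succ, not_false_eq_true, and_true]
  rw [deltaB, peakSetB_eq hI]
  split_ifs with h0
  · rw [peakFun1, Finset.card_erase_add_one (zero_mem.2 h0)]
    have split_zero (J : Finset ℕ) : PeakCompatible (runStarts I) J ↔
        0 ∈ J ∧ PeakCompatible ((runStarts I).erase 0) J := by
      rw [← zero_mem_symmDiff_image_succ, ← peakCompatible_insert,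
        Finset.insert_erase (zero_mem.2 h0)]
    simp only [split_zero]
  · rw [peakFun0, Finset.erase_eq_of_notMem (mt zero_mem.1 h0)]

theorem two_mul_card_filter_of_involutive {α : Type*} {F : Finset α} {p : α → Prop}
    [DecidablePred p] {f : α → α} (hf : Function.Involutive f) (hF : ∀ x ∈ F, f x ∈ F)
    (hp : ∀ x, p (f x) ↔ ¬ p x) : 2 * (F.filter p).card = F.card := by
  have h : (F.filter p).card = (F.filter fun x => ¬ p x).card := by
    refine Finset.card_nbij' f f ?_ ?_ (fun x _ => hf x) (fun x _ => hf x) <;> intro x hx <;>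
      simp_all
  rw [two_mul]
  nth_rw 2 [h]
  exact Finset.card_filter_add_card_filter_not p

theorem symmDiff_image_succ_toggle (J : Finset ℕ) (r : ℕ) :
    symmDiff (symmDiff J {r}) ((symmDiff J {r}).image (· + 1)) =
      symmDiff (symmDiff J (J.image (· + 1))) {r, r + 1} := by
  have pair : symmDiff {r} {r + 1} = ({r, r + 1} : Finset ℕ) :=
    Finset.symmDiff_eq_union (Finset.disjoint_singleton.2 (Nat.ne_add_one r))
  rw [Finset.image_symmDiff _ _ (add_left_injective 1), Finset.image_singleton,
    symmDiff_symmDiff_symmDiff_comm, pair]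

theorem peakCompatible_toggle {P J : Finset ℕ} {r : ℕ} (hr : r ∉ P) (hr' : r + 1 ∉ P) :
    PeakCompatible P (symmDiff J {r}) ↔ PeakCompatible P J := by
  refine forall₂_congr fun p hp => ?_
  rw [symmDiff_image_succ_toggle, Finset.mem_symmDiff]
  have : p ∉ ({r, r + 1} : Finset ℕ) := by
    rw [Finset.mem_insert, Finset.mem_singleton]
    rintro (rfl | rfl) <;> contradiction
  tauto

open Classical in
theorem two_mul_card_peakCompatible_insert {S P : Finset ℕ} {q r : ℕ} (hrS : r ∈ S) (hr : r ∉ P)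
    (hr' : r + 1 ∉ P) (hq : q ∈ ({r, r + 1} : Finset ℕ)) :
    2 * (S.powerset.filter (PeakCompatible (insert q P))).card =
      (S.powerset.filter (PeakCompatible P)).card := by
  simp only [peakCompatible_insert]
  rw [← two_mul_card_filter_of_involutive (F := S.powerset.filter (PeakCompatible P))
    (p := fun J => q ∈ symmDiff J (J.image (· + 1))) (symmDiff_left_involutive {r}),
    Finset.filter_filter]
  · simp only [and_comm]
  · intro J hJ
    rw [Finset.mem_filter, Finset.mem_powerset] at hJ ⊢
    exact ⟨Finset.symmDiff_subset_union.trans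
        (Finset.union_subset hJ.1 (Finset.singleton_subset_iff.2 hrS)),
      (peakCompatible_toggle hr hr').2 hJ.2⟩
  · intro J
    rw [symmDiff_image_succ_toggle, Finset.mem_symmDiff]
    tauto

open Classical in
theorem two_pow_mul_card_peakCompatible {S P : Finset ℕ} (hP : ∀ p ∈ P, p + 1 ∉ P)
    (hS : P ⊆ S ∪ S.image (· + 1)) :
    2 ^ P.card * (S.powerset.filter (PeakCompatible P)).card = 2 ^ S.card := by
  induction P using Finset.induction_on with
  | empty =>
    have all_compatible : S.powerset.filter (PeakCompatible ∅) = S.powerset :=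
      Finset.filter_true_of_mem fun J _ => Finset.empty_subset _
    rw [all_compatible, Finset.card_empty, pow_zero, one_mul, Finset.card_powerset]
  | insert q P hq ih =>
    rw [Finset.insert_subset_iff] at hS
    have hP' : ∀ p ∈ P, p + 1 ∉ P := fun p hp h =>
      hP p (Finset.mem_insert_of_mem hp) (Finset.mem_insert_of_mem h)
    obtain ⟨r, hrS, hqr⟩ : ∃ r ∈ S, q = r ∨ q = r + 1 := by
      rcases Finset.mem_union.1 hS.1 with h | h
      · exact ⟨q, h, .inl rfl⟩
      · obtain ⟨r, hr, rfl⟩ := Finset.mem_image.1 h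
        exact ⟨r, hr, .inr rfl⟩
    have hrP : r ∉ P ∧ r + 1 ∉ P := by
      rcases hqr with rfl | rfl
      · exact ⟨hq, fun h => hP q (Finset.mem_insert_self q P) (Finset.mem_insert_of_mem h)⟩
      · exact ⟨fun h => hP r (Finset.mem_insert_of_mem h) (Finset.mem_insert_self _ P), hq⟩
    have hq_mem : q ∈ ({r, r + 1} : Finset ℕ) := by
      rwa [Finset.mem_insert, Finset.mem_singleton]
    rw [Finset.card_insert_of_notMem hq, pow_succ, mul_assoc,
      two_mul_card_peakCompatible_insert hrS hrP.1 hrP.2 hq_mem, ih hP' hS.2]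

theorem PeakCompatible.subset_union {P J S : Finset ℕ} (h : PeakCompatible P J) (hJ : J ⊆ S) :
    P ⊆ S ∪ S.image (· + 1) :=
  h.trans (Finset.symmDiff_subset_union.trans
    (Finset.union_subset_union hJ (Finset.image_subset_image hJ)))

theorem sdiff_subset_image_succ_iff {I S : Finset ℕ} :
    I \ S ⊆ (I ∪ S).image (· + 1) ↔ runStarts I ⊆ S ∪ S.image (· + 1) := by
  rw [Finset.image_union, runStarts]
  simp only [← Finset.sup_eq_union, sdiff_le_iff]
  rw [sup_left_comm]

open Classical in
theorem card_Icc_eq_two_pow_mul_card_peakCompatible (I S : Finset ℕ) :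
    (Finset.Icc (I \ S) ((I ∪ S).image (· + 1))).card =
      2 ^ (runStarts I).card * (S.powerset.filter (PeakCompatible (runStarts I))).card := by
  by_cases h : runStarts I ⊆ S ∪ S.image (· + 1)
  · have hcard : ((I ∪ S).image (· + 1)).card = (I \ S).card + S.card := by
      rw [Finset.card_image_of_injective _ (add_left_injective 1), Finset.card_sdiff_add_card]
    rw [two_pow_mul_card_peakCompatible (fun _ => succ_notMem_runStarts) h,
      Finset.card_Icc_finset (sdiff_subset_image_succ_iff.2 h), hcard, Nat.add_sub_cancel_left]
  · have hempty : S.powerset.filter (PeakCompatible (runStarts I)) = ∅ :=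
      Finset.filter_eq_empty_iff.2 fun J hJ hc => h (hc.subset_union (Finset.mem_powerset.1 hJ))
    rw [hempty, Finset.card_empty, mul_zero, Finset.card_eq_zero, Finset.Icc_eq_empty_iff]
    exact mt sdiff_subset_image_succ_iff.1 h

/-! ### Enriched sequences -/

namespace Letter

/-- Whether the letter carries a prime. -/
def isPrimed : Letter → Bool
  | unprimed _ => false
  | primed _ => true

/-- The letter with absolute value `k` that carries a prime if `b` is true and `k` is positive;
there is no letter `0'`. -/
def ofAbs (k : ℕ) (b : Bool) : Letter :=
  if h : b = true ∧ 0 < k then primed ⟨k, h.2⟩ else unprimed k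

theorem abs_ofAbs (k : ℕ) (b : Bool) : (ofAbs k b).abs = k := by
  unfold ofAbs
  split_ifs <;> rfl

theorem isPrimed_ofAbs {k : ℕ} {b : Bool} (h : b = true → 0 < k) : (ofAbs k b).isPrimed = b := by
  unfold ofAbs
  split_ifs with h'
  · exact h'.1.symm
  · exact (Bool.eq_false_iff.2 fun hb => h' ⟨hb, h hb⟩).symm

theorem eq_of_abs_of_isPrimed {x y : Letter} (h : x.abs = y.abs)
    (h' : x.isPrimed = y.isPrimed) : x = y := by
  rcases x with a | a <;> rcases y with b | b
  · exact congrArg unprimed h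
  · cases h'
  · cases h'
  · exact congrArg primed (PNat.coe_injective h)

theorem le_iff_rank {x y : Letter} : x ≤ y ↔ x.rank ≤ y.rank := Iff.rfl

theorem unprimed_zero_le (x : Letter) : unprimed 0 ≤ x := le_iff_rank.2 (Nat.zero_le _)

theorem le_and_isPrimed_iff_of_eq_iff {x y : Letter} {D : Prop} :
    (x ≤ y ∧ (x = y → (x.isPrimed = true ↔ D))) ↔
      x.abs ≤ y.abs ∧ (x.abs = y.abs → (D → x.isPrimed = true) ∧ (¬ D → ¬ y.isPrimed = true)) := by
  rw [le_iff_rank]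
  rcases x with a | a <;> rcases y with b | b
  · simp only [rank, abs, isPrimed, unprimed.injEq]
    grind
  · have := b.pos
    simp only [rank, abs, isPrimed, reduceCtorEq]
    grind
  · have := a.pos
    simp only [rank, abs, isPrimed, reduceCtorEq]
    grind
  · have := a.pos
    have := b.pos
    simp only [rank, abs, isPrimed, primed.injEq, ← PNat.coe_inj]
    grind

end Letter

/-- Sequences of letters `0 = a_0 ≤ a_1 ≤ ⋯ ≤ a_n` in which equal consecutive letters
`a_j = a_{j+1}` are primed if `j ∈ I` and unprimed if `j ∉ I`. They are the fillings of a standard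
tableau with descent set `I` that standardize to it. -/
def EnrichedSeq (n : ℕ) (I : Finset ℕ) : Type :=
  {a : Fin (n + 1) → Letter // a 0 = Letter.unprimed 0 ∧ ∀ j : Fin n, a j.castSucc ≤ a j.succ ∧
    (a j.castSucc = a j.succ → ((a j.castSucc).isPrimed = true ↔ (j : ℕ) ∈ I))}

namespace EnrichedSeq

variable {n : ℕ} {I : Finset ℕ}

theorem monotone (a : EnrichedSeq n I) : Monotone a.1 :=
  Fin.monotone_iff_le_succ.2 fun j => (a.2.2 j).1

/-- The weakly increasing sequence `|a_0| ≤ ⋯ ≤ |a_n|`. -/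
def absSeq (a : EnrichedSeq n I) : FundSeq n ∅ :=
  ⟨fun j => (a.1 j).abs, congrArg Letter.abs a.2.1,
    Fin.monotone_iff_le_succ.2 fun j => (Letter.le_and_isPrimed_iff_of_eq_iff.1 (a.2.2 j)).1,
    fun _ h => absurd h (Finset.notMem_empty _)⟩

/-- The exponent of the monomial `x_{|a_1|} ⋯ x_{|a_n|}`. -/
noncomputable def wt (a : EnrichedSeq n I) : ℕ →₀ ℕ := a.absSeq.wt

end EnrichedSeq

/-- The set of those `j` with `i_j < i_{j+1}`. -/
def strictSteps {n : ℕ} (i : Fin (n + 1) → ℕ) : Finset ℕ :=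
  (Finset.univ.filter fun j : Fin n => i j.castSucc < i j.succ).map Fin.valEmbedding

/-- The set of positions of the primed letters of a sequence. -/
def primedPositions {n : ℕ} (a : Fin (n + 1) → Letter) : Finset ℕ :=
  (Finset.univ.filter fun j => (a j).isPrimed = true).map Fin.valEmbedding

section Positions

variable {n : ℕ}

theorem mem_strictSteps {i : Fin (n + 1) → ℕ} {j : Fin n} :
    (j : ℕ) ∈ strictSteps i ↔ i j.castSucc < i j.succ :=
  (Finset.mem_map' Fin.valEmbedding).trans (Finset.mem_filter_univ j)

theorem mem_primedPositions {a : Fin (n + 1) → Letter} {j : Fin (n + 1)} :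
    (j : ℕ) ∈ primedPositions a ↔ (a j).isPrimed = true :=
  (Finset.mem_map' Fin.valEmbedding).trans (Finset.mem_filter_univ j)

theorem primedPositions_subset (a : Fin (n + 1) → Letter) :
    primedPositions a ⊆ Finset.range (n + 1) := fun x hx => by
  obtain ⟨j, -, rfl⟩ := Finset.mem_map.1 hx
  exact Finset.mem_range.2 j.2

theorem strictSteps_subset (i : Fin (n + 1) → ℕ) : strictSteps i ⊆ Finset.range n := fun x hx => by
  obtain ⟨j, -, rfl⟩ := Finset.mem_map.1 hx
  exact Finset.mem_range.2 j.2

theorem subset_strictSteps_iff {i : Fin (n + 1) → ℕ} {J : Finset ℕ} (hJ : J ⊆ Finset.range n) :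
    J ⊆ strictSteps i ↔ ∀ j : Fin n, (j : ℕ) ∈ J → i j.castSucc < i j.succ :=
  ⟨fun h _ hj => mem_strictSteps.1 (h hj),
    fun h x hx => mem_strictSteps (j := ⟨x, Finset.mem_range.1 (hJ hx)⟩).2 (h _ hx)⟩

theorem primedPositions_ofAbs {i : Fin (n + 1) → ℕ} {U : Finset ℕ} (hU : U ⊆ Finset.range (n + 1))
    (hpos : ∀ j : Fin (n + 1), (j : ℕ) ∈ U → 0 < i j) :
    primedPositions (fun j => Letter.ofAbs (i j) (decide ((j : ℕ) ∈ U))) = U := by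
  have mem_iff (j : Fin (n + 1)) :
      (j : ℕ) ∈ primedPositions (fun j => Letter.ofAbs (i j) (decide ((j : ℕ) ∈ U))) ↔
        (j : ℕ) ∈ U := by
    rw [mem_primedPositions, Letter.isPrimed_ofAbs fun h => hpos j (of_decide_eq_true h),
      decide_eq_true_iff]
  ext x
  by_cases hx : x < n + 1
  · exact mem_iff ⟨x, hx⟩
  · exact iff_of_false (fun h => hx (Finset.mem_range.1 (primedPositions_subset _ h)))
      fun h => hx (Finset.mem_range.1 (hU h))

variable {I U : Finset ℕ}

theorem mem_Icc_strictSteps_iff (hI : I ⊆ Finset.range n) {i : Fin (n + 1) → ℕ} :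
    U ∈ Finset.Icc (I \ strictSteps i) ((I ∪ strictSteps i).image (· + 1)) ↔
      (U ⊆ Finset.range (n + 1) ∧ 0 ∉ U) ∧ ∀ j : Fin n, ¬ i j.castSucc < i j.succ →
        ((j : ℕ) ∈ I → (j : ℕ) ∈ U) ∧ ((j : ℕ) ∉ I → (j : ℕ) + 1 ∉ U) := by
  rw [Finset.mem_Icc]
  constructor
  · rintro ⟨hlow, hup⟩
    refine ⟨⟨fun x hx => ?_, fun h0 => zero_notMem_image_succ _ (hup h0)⟩, fun j hj => ⟨?_, ?_⟩⟩
    · obtain ⟨y, hy, rfl⟩ := Finset.mem_image.1 (hup hx)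
      have := Finset.mem_range.1 (Finset.union_subset hI (strictSteps_subset i) hy)
      exact Finset.mem_range.2 (Nat.succ_lt_succ this)
    · exact fun hjI => hlow (Finset.mem_sdiff.2 ⟨hjI, mt mem_strictSteps.1 hj⟩)
    · intro hjI hjU
      rcases Finset.mem_union.1 (mem_image_succ.1 (hup hjU)) with h | h
      exacts [hjI h, hj (mem_strictSteps.1 h)]
  · rintro ⟨⟨hU, h0⟩, h⟩
    constructor
    · intro x hx
      rw [Finset.mem_sdiff] at hx
      have hxn := Finset.mem_range.1 (hI hx.1)
      exact (h ⟨x, hxn⟩ (mt mem_strictSteps.2 hx.2)).1 hx.1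
    · rintro (_ | x) hx
      · exact absurd hx h0
      · have hxn := Nat.lt_of_succ_lt_succ (Finset.mem_range.1 (hU hx))
        rw [mem_image_succ, Finset.mem_union]
        by_contra! hxIS
        exact (h ⟨x, hxn⟩ (mt mem_strictSteps.2 hxIS.2)).2 hxIS.1 hx

/-- A primed position after a weak step is preceded by a primed position, and the value after a
strict step is positive. -/
theorem pos_of_mem_of_weak_step {i : Fin (n + 1) → ℕ} (hi : Monotone i)
    (hU : 0 ∉ U ∧ ∀ j : Fin n, ¬ i j.castSucc < i j.succ →
      ((j : ℕ) ∈ I → (j : ℕ) ∈ U) ∧ ((j : ℕ) ∉ I → (j : ℕ) + 1 ∉ U)) (j : Fin (n + 1))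
    (hj : (j : ℕ) ∈ U) : 0 < i j := by
  induction j using Fin.induction with
  | zero => exact absurd hj hU.1
  | succ j ih =>
    by_cases hstep : i j.castSucc < i j.succ
    · exact (Nat.zero_le _).trans_lt hstep
    · have hjI : (j : ℕ) ∈ I := by_contra fun h => (hU.2 j hstep).2 h hj
      exact (ih ((hU.2 j hstep).1 hjI)).trans_le (hi (Fin.castSucc_le_succ j))

end Positions

namespace EnrichedSeq

variable {n : ℕ} {I : Finset ℕ}

theorem primedPositions_mem_Icc (hI : I ⊆ Finset.range n) (a : EnrichedSeq n I) :
    primedPositions a.1 ∈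
      Finset.Icc (I \ strictSteps a.absSeq.1) ((I ∪ strictSteps a.absSeq.1).image (· + 1)) := by
  refine (mem_Icc_strictSteps_iff hI).2 ⟨⟨primedPositions_subset a.1, fun h0 => ?_⟩, fun j hj => ?_⟩
  · have := mem_primedPositions (j := 0).1 h0
    rw [a.2.1] at this
    cases this
  · have step := Letter.le_and_isPrimed_iff_of_eq_iff.1 (a.2.2 j)
    have weak := step.2 (le_antisymm step.1 (not_lt.1 hj))
    exact ⟨fun h => mem_primedPositions (j := j.castSucc).2 (weak.1 h),
      fun h h' => weak.2 h (mem_primedPositions (j := j.succ).1 h')⟩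

theorem ext_of_absSeq_of_primedPositions {a b : EnrichedSeq n I} (h : a.absSeq = b.absSeq)
    (h' : primedPositions a.1 = primedPositions b.1) : a = b := by
  refine Subtype.ext (funext fun j => Letter.eq_of_abs_of_isPrimed ?_ ?_)
  · exact congrFun (congrArg Subtype.val h) j
  · rw [Bool.eq_iff_iff, ← mem_primedPositions, ← mem_primedPositions, h']

theorem exists_absSeq_eq_primedPositions_eq (hI : I ⊆ Finset.range n) (i : FundSeq n ∅)
    {U : Finset ℕ}
    (hU : U ∈ Finset.Icc (I \ strictSteps i.1) ((I ∪ strictSteps i.1).image (· + 1))) :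
    ∃ a : EnrichedSeq n I, a.absSeq = i ∧ primedPositions a.1 = U := by
  obtain ⟨⟨hUn, h0⟩, weak⟩ := (mem_Icc_strictSteps_iff hI).1 hU
  have hpos := pos_of_mem_of_weak_step i.2.2.1 ⟨h0, weak⟩
  have isPrimed_iff (j : Fin (n + 1)) :
      (Letter.ofAbs (i.1 j) (decide ((j : ℕ) ∈ U))).isPrimed = true ↔ (j : ℕ) ∈ U := by
    rw [Letter.isPrimed_ofAbs fun h => hpos j (of_decide_eq_true h), decide_eq_true_iff]
  refine ⟨⟨fun j => Letter.ofAbs (i.1 j) (decide ((j : ℕ) ∈ U)), ?_, fun j => ?_⟩, ?_, ?_⟩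
  · simp [i.2.1, Letter.ofAbs]
  · rw [Letter.le_and_isPrimed_iff_of_eq_iff, isPrimed_iff, isPrimed_iff, Letter.abs_ofAbs,
      Letter.abs_ofAbs]
    exact ⟨i.2.2.1 (Fin.castSucc_le_succ j), fun heq => weak j heq.not_lt⟩
  · exact Subtype.ext (funext fun j => Letter.abs_ofAbs _ _)
  · exact primedPositions_ofAbs hUn hpos

/-- An enriched sequence with given absolute values is determined by the set of its primed
positions, and the sets that occur form an interval of finite sets. -/
noncomputable def absSeqFiberEquiv (hI : I ⊆ Finset.range n) (i : FundSeq n ∅) :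
    {a : EnrichedSeq n I // a.absSeq = i} ≃
      Finset.Icc (I \ strictSteps i.1) ((I ∪ strictSteps i.1).image (· + 1)) :=
  Equiv.ofBijective (fun a => ⟨primedPositions a.1.1, by
    obtain ⟨a, rfl⟩ := a
    exact primedPositions_mem_Icc hI a⟩) <| by
    refine ⟨fun a b hab => Subtype.ext ?_, fun ⟨U, hU⟩ => ?_⟩
    · exact ext_of_absSeq_of_primedPositions (a.2.trans b.2.symm) (congrArg Subtype.val hab)
    · obtain ⟨a, ha, haU⟩ := exists_absSeq_eq_primedPositions_eq hI i hU
      exact ⟨⟨a, ha⟩, Subtype.ext haU⟩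

end EnrichedSeq

namespace FundSeq

variable {n : ℕ}

/-- The sequence with the requirement of strict steps forgotten. -/
def weaken {J : Finset ℕ} (i : FundSeq n J) : FundSeq n ∅ :=
  ⟨i.1, i.2.1, i.2.2.1, fun _ h => absurd h (Finset.notMem_empty _)⟩

open Classical in
/-- The sequences with required strict steps that weaken to `i`, the set of required steps being
any set with property `p` that carries a label in `α`, correspond to the labelled subsets of the
set of strict steps of `i` that have property `p`. -/
noncomputable def weakenFiberEquiv {α : Type} (p : Finset ℕ → Prop) (i : FundSeq n ∅) :
    {x : Σ y : α × {J // J ∈ (Finset.range n).powerset.filter p}, FundSeq n y.2.1 //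
        x.2.weaken = i} ≃
      α × {J // J ∈ (strictSteps i.1).powerset.filter p} where
  toFun x := (x.1.1.1, ⟨x.1.1.2.1, by
    obtain ⟨⟨⟨_, J, hJ⟩, s⟩, rfl⟩ := x
    rw [Finset.mem_filter, Finset.mem_powerset] at hJ ⊢
    exact ⟨(subset_strictSteps_iff hJ.1).2 s.2.2.2, hJ.2⟩⟩)
  invFun y := ⟨⟨(y.1, ⟨y.2.1, by
      have hJ := y.2.2
      rw [Finset.mem_filter, Finset.mem_powerset] at hJ ⊢
      exact ⟨hJ.1.trans (strictSteps_subset i.1), hJ.2⟩⟩), i.1, i.2.1, i.2.2.1, fun j hj => by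
        have hJ := Finset.mem_powerset.1 (Finset.mem_filter.1 y.2.2).1
        exact mem_strictSteps.1 (hJ hj)⟩, rfl⟩
  left_inv := by
    rintro ⟨⟨⟨_, J, hJ⟩, s⟩, rfl⟩
    rfl
  right_inv _ := rfl

end FundSeq

/-- Both sides are graded by weakly increasing sequences `i`, and the fibres over `i` have the same
number of elements. -/
theorem deltaB_eq_genFun {n : ℕ} {I : Finset ℕ} (hI : I ⊆ Finset.range n) :
    deltaB n I = genFun (EnrichedSeq.wt : EnrichedSeq n I → ℕ →₀ ℕ) := by
  classical
  let Labels := Fin (2 ^ (runStarts I).card) ×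
    {J // J ∈ (Finset.range n).powerset.filter (PeakCompatible (runStarts I))}
  have fiberEquiv (i : FundSeq n ∅) : {a : EnrichedSeq n I // a.absSeq = i} ≃
      {x : Σ y : Labels, FundSeq n y.2.1 // x.2.weaken = i} := by
    refine (EnrichedSeq.absSeqFiberEquiv hI i).trans
      ((Fintype.equivOfCardEq ?_).trans (FundSeq.weakenFiberEquiv _ i).symm)
    rw [Fintype.card_prod, Fintype.card_fin, Fintype.card_coe, Fintype.card_coe]
    convert card_Icc_eq_two_pow_mul_card_peakCompatible I (strictSteps i.1)
  calc deltaB n I = ∑ y : Labels, fundB n y.2.1 := by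
        rw [deltaB_eq hI, Fintype.sum_prod_type]
        dsimp only
        rw [Finset.sum_const, Finset.card_univ, Fintype.card_fin, nsmul_eq_mul, Nat.cast_pow,
          Nat.cast_ofNat, Finset.sum_coe_sort _ fun J => fundB n J]
    _ = genFun fun x : Σ y : Labels, FundSeq n y.2.1 => x.2.wt :=
        (genFun_sigma (fun y : Labels => FundSeq.wt (I := y.2.1))
          fun y e => FundSeq.finite_wt_eq n y.2.1 e).symm
    _ = genFun (EnrichedSeq.wt : EnrichedSeq n I → ℕ →₀ ℕ) :=
        genFun_congr (Equiv.ofFiberEquiv fiberEquiv) fun a =>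
          congrArg FundSeq.wt (Equiv.ofFiberEquiv_map fiberEquiv a)

/-! ### Geometry of dominoes -/

/-- The row index of a cell if `b` is true, and its column index otherwise. Primed letters control
rows and unprimed letters control columns, so `b` is usually `x.isPrimed` for a letter `x`. -/
def coord : Bool → ℕ × ℕ → ℕ
  | true => Prod.fst
  | false => Prod.snd

/-- The domino `d` lies entirely above `e` (if `b` is true) or entirely to the left of `e`
(otherwise). -/
def Precedes (b : Bool) (d e : Cells) : Prop := ∀ c ∈ d, ∀ c' ∈ e, coord b c < coord b c'

theorem coord_mono (b : Bool) : Monotone (coord b) := fun _ _ h =>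
  match b with
  | true => h.1
  | false => h.2

variable {b : Bool} {d e f : Cells}

theorem IsDomino.nonempty (hd : IsDomino d) : d.Nonempty := by
  rcases hd with ⟨i, j, rfl⟩ | ⟨i, j, rfl⟩ <;> exact Finset.insert_nonempty _ _

theorem IsDomino.coord_le (hd : IsDomino d) {c c' : ℕ × ℕ} (hc : c ∈ d) (hc' : c' ∈ d) :
    coord b c ≤ coord b c' + 1 := by
  rcases hd with ⟨i, j, rfl⟩ | ⟨i, j, rfl⟩ <;>
    rw [Finset.mem_insert, Finset.mem_singleton] at hc hc' <;>
    rcases hc with rfl | rfl <;> rcases hc' with rfl | rfl <;> cases b <;>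
    simp only [coord] <;> omega

theorem IsDomino.mk_mem (hd : IsDomino d) {c c' : ℕ × ℕ} (hc : c ∈ d) (hc' : c' ∈ d) :
    (c.1, c'.2) ∈ d := by
  rcases hd with ⟨i, j, rfl⟩ | ⟨i, j, rfl⟩ <;>
    rw [Finset.mem_insert, Finset.mem_singleton] at hc hc' <;>
    rcases hc with rfl | rfl <;> rcases hc' with rfl | rfl <;> simp

theorem not_isHorizontal_and_isVertical : ¬ (IsHorizontal d ∧ IsVertical d) := by
  rintro ⟨⟨i, j, rfl⟩, i', j', h⟩
  have h₁ : (i, j) ∈ ({(i', j'), (i' + 1, j')} : Cells) := h ▸ by simp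
  have h₂ : (i, j + 1) ∈ ({(i', j'), (i' + 1, j')} : Cells) := h ▸ by simp
  simp only [Finset.mem_insert, Finset.mem_singleton, Prod.mk.injEq] at h₁ h₂
  omega

theorem not_shareRow_of_shareColumn (hd : IsDomino d) (he : IsDomino e) (hde : Disjoint d e)
    (h : ShareColumn d e) : ¬ ShareRow d e := by
  obtain ⟨c, hc, c', hc', hcol⟩ := h
  rintro ⟨x, hx, x', hx', hrow⟩
  have hmem := he.mk_mem hx' hc'
  rw [← hrow, ← hcol] at hmem
  exact Finset.disjoint_left.1 hde (hd.mk_mem hx hc) hmem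

theorem WeaklyAboveDiagonal.exists_top (hd : IsDomino d) (h : WeaklyAboveDiagonal d) :
    ∃ c ∈ d, c.1 ≤ c.2 ∧ ∀ c' ∈ d, c.1 ≤ c'.1 := by
  obtain ⟨c, hc, hle⟩ := h
  obtain ⟨x, hx, hmin⟩ := d.exists_min_image Prod.fst ⟨c, hc⟩
  exact ⟨_, hd.mk_mem hx hc, (hmin c hc).trans hle, hmin⟩

namespace Precedes

theorem trans (he : e.Nonempty) (h : Precedes b d e) (h' : Precedes b e f) : Precedes b d f := by
  obtain ⟨x, hx⟩ := he
  exact fun c hc c' hc' => (h c hc x hx).trans (h' x hx c' hc')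

theorem sup_lt (hd : d.Nonempty) (he : e.Nonempty) (h : Precedes b d e) :
    d.sup (coord b) < e.sup (coord b) := by
  obtain ⟨c, hc, hsup⟩ := d.exists_mem_eq_sup hd (coord b)
  obtain ⟨c', hc'⟩ := he
  exact hsup ▸ (h c hc c' hc').trans_le (Finset.le_sup hc')

end Precedes

theorem precedes_or_precedes (hd : IsDomino d) (he : IsDomino e)
    (h : ∀ c ∈ d, ∀ c' ∈ e, coord b c ≠ coord b c') : Precedes b d e ∨ Precedes b e d := by
  obtain ⟨x, hx⟩ := hd.nonempty
  obtain ⟨y, hy⟩ := he.nonempty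
  have between {c c' : ℕ × ℕ} (hc : c ∈ d) (hc' : c' ∈ e) :
      coord b c < coord b c' ↔ coord b x < coord b y := by
    have := h c hc c' hc'
    have := h x hx c' hc'
    have := h c hc y hy
    have := h x hx y hy
    have := hd.coord_le (b := b) hc hx
    have := hd.coord_le (b := b) hx hc
    have := he.coord_le (b := b) hc' hy
    have := he.coord_le (b := b) hy hc'
    omega
  rcases lt_or_gt_of_ne (h x hx y hy) with hlt | hgt
  · exact Or.inl fun c hc c' hc' => (between hc hc').2 hlt
  · exact Or.inr fun c' hc' c hc =>
      (h c hc c' hc').lt_or_gt.resolve_left fun hlt => hgt.asymm ((between hc hc').1 hlt)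

theorem precedes_of_sup_lt (hd : IsDomino d) (he : IsDomino e)
    (h : ∀ c ∈ d, ∀ c' ∈ e, coord b c ≠ coord b c')
    (hlt : d.sup (coord b) < e.sup (coord b)) : Precedes b d e :=
  (precedes_or_precedes hd he h).resolve_right fun h' =>
    hlt.asymm (h'.sup_lt he.nonempty hd.nonempty)

/-! ### The dominoes weakly above the diagonal -/

theorem mem_upperDominoes {t : Finset Cells} :
    d ∈ upperDominoes t ↔ d ∈ t ∧ WeaklyAboveDiagonal d := by
  classical
  exact Finset.mem_filter

namespace IsUpperPart

variable {lam : YoungDiagram} {s : Finset Cells}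

theorem isDomino (hs : IsUpperPart lam s) (hd : d ∈ s) : IsDomino d := by
  obtain ⟨t, ht, rfl⟩ := hs
  exact ht.1.1 d (mem_upperDominoes.1 hd).1

theorem weaklyAboveDiagonal (hs : IsUpperPart lam s) (hd : d ∈ s) : WeaklyAboveDiagonal d := by
  obtain ⟨t, -, rfl⟩ := hs
  exact (mem_upperDominoes.1 hd).2

theorem disjoint (hs : IsUpperPart lam s) (hd : d ∈ s) (he : e ∈ s) (hne : d ≠ e) :
    Disjoint d e := by
  obtain ⟨t, ht, rfl⟩ := hs
  exact ht.1.2.1 (mem_upperDominoes.1 hd).1 (mem_upperDominoes.1 he).1 hne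

theorem eq_of_mem_of_mem (hs : IsUpperPart lam s) {d e : {d // d ∈ s}} {c : ℕ × ℕ}
    (hd : c ∈ d.1) (he : c ∈ e.1) : d = e := by
  by_contra hne
  exact Finset.disjoint_left.1 (hs.disjoint d.2 e.2 (Subtype.coe_ne_coe.2 hne)) hd he

theorem exists_mem_of_le (hs : IsUpperPart lam s) (d : {d // d ∈ s}) {c c' : ℕ × ℕ}
    (hc' : c' ∈ d.1) (hle : c ≤ c') (hup : c.1 ≤ c.2) : ∃ g : {d // d ∈ s}, c ∈ g.1 := by
  obtain ⟨d, hd⟩ := d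
  obtain ⟨t, ht, rfl⟩ := hs
  have mem_lam_iff {x : ℕ × ℕ} : x ∈ lam.cells ↔ ∃ g ∈ t, x ∈ g := by
    rw [← ht.1.2.2]
    exact Finset.mem_biUnion
  have hc'lam : c' ∈ lam.cells := mem_lam_iff.2 ⟨d, (mem_upperDominoes.1 hd).1, hc'⟩
  obtain ⟨g, hg, hcg⟩ := mem_lam_iff.1 (lam.isLowerSet hle hc'lam)
  exact ⟨⟨g, mem_upperDominoes.2 ⟨hg, c, hcg, hup⟩⟩, hcg⟩

/-- One goes from `c` to `c'` first along the row of `c` and then down the column of `c'`; this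
path stays weakly above the diagonal. -/
theorem entry_le (hs : IsUpperPart lam s) {α : Type*} [Preorder α] {entry : {d // d ∈ s} → α}
    (hrow : ∀ d e : {d // d ∈ s}, LeftInRow d.1 e.1 → entry d ≤ entry e)
    (hcol : ∀ d e : {d // d ∈ s}, AboveInColumn d.1 e.1 → entry d ≤ entry e)
    {d e : {d // d ∈ s}} {c c' : ℕ × ℕ} (hc : c ∈ d.1) (hc' : c' ∈ e.1) (hle : c ≤ c')
    (hup : c.1 ≤ c.2) : entry d ≤ entry e := by
  obtain ⟨r, k⟩ := c
  obtain ⟨r', k'⟩ := c'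
  obtain ⟨hr : r ≤ r', hk : k ≤ k'⟩ := hle
  obtain ⟨g, hg⟩ := hs.exists_mem_of_le e (c := (r, k')) hc' ⟨hr, le_rfl⟩ (hup.trans hk)
  have hdg : entry d ≤ entry g := by
    rcases hk.eq_or_lt with rfl | hlt
    · rw [hs.eq_of_mem_of_mem hc hg]
    · exact hrow d g ⟨_, hc, _, hg, rfl, hlt⟩
  have hge : entry g ≤ entry e := by
    rcases hr.eq_or_lt with rfl | hlt
    · rw [hs.eq_of_mem_of_mem hc' hg]
    · exact hcol g e ⟨_, hg, _, hc', rfl, hlt⟩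
  exact hdg.trans hge

end IsUpperPart

/-! ### Ranking -/

theorem existsUnique_ranking {α β : Type*} [Fintype α] [LinearOrder β] {κ : α → β}
    (hκ : Function.Injective κ) :
    ∃! q : α → ℕ, Set.range q = Set.Icc 1 (Fintype.card α) ∧ ∀ x y, q x < q y ↔ κ x < κ y := by
  let : LinearOrder α := LinearOrder.lift' κ hκ
  let rank := (Fintype.orderIsoFinOfCardEq α rfl).symm
  have rank_range : Set.range (fun x => (rank x : ℕ) + 1) = Set.Icc 1 (Fintype.card α) := by
    ext k
    constructor
    · rintro ⟨x, rfl⟩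
      exact ⟨Nat.le_add_left _ _, (rank x).2⟩
    · rintro ⟨h1, h2⟩
      obtain ⟨k, rfl⟩ := Nat.exists_eq_add_of_le' h1
      exact ⟨rank.symm ⟨k, h2⟩, by simp only [OrderIso.apply_symm_apply]⟩
  have rank_lt (x y : α) : (rank x : ℕ) + 1 < rank y + 1 ↔ κ x < κ y :=
    Nat.succ_lt_succ_iff.trans rank.lt_iff_lt
  refine ⟨fun x => rank x + 1, ⟨rank_range, rank_lt⟩, fun q hq => ?_⟩
  have rank_mono : StrictMono fun x => (rank x : ℕ) + 1 := fun x y => (rank_lt x y).2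
  have q_mono : StrictMono q := fun x y => (hq.2 x y).2
  exact (q_mono.range_inj rank_mono).1 (hq.1.trans rank_range.symm)

/-! ### Filling standard tableaux with letters -/

/-- The key by which the dominoes of a semistandard tableau are sorted: among dominoes with the
same letter, primed ones are read from top to bottom and unprimed ones from left to right. -/
def sortKey (x : Letter) (d : Cells) : Letter ×ₗ ℕ :=
  toLex (x, d.sup (coord x.isPrimed))

theorem sortKey_lt_iff {x y : Letter} {d e : Cells} :
    sortKey x d < sortKey y e ↔
      x < y ∨ x = y ∧ d.sup (coord x.isPrimed) < e.sup (coord x.isPrimed) := by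
  rw [sortKey, sortKey, Prod.Lex.toLex_lt_toLex]
  exact or_congr_right (and_congr_right fun h : x = y => by rw [h])

namespace SShDT

variable {lam : YoungDiagram} (Q : SShDT lam)

theorem entry_mem (d : {d // d ∈ Q.dominoes}) : Q.entry d ∈ Set.Icc 1 Q.size :=
  Q.range_eq ▸ Set.mem_range_self d

theorem exists_entry_eq {k : ℕ} (hk : k ∈ Set.Icc 1 Q.size) : ∃ d, Q.entry d = k := by
  rwa [size, ← Q.range_eq] at hk

/-- The position of a domino, so that its entry is the successor of its position. -/
noncomputable def dominoEquiv : {d // d ∈ Q.dominoes} ≃ Fin Q.size :=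
  Equiv.ofBijective
    (fun d => ⟨Q.entry d - 1, Nat.sub_one_lt_of_le (Q.entry_mem d).1 (Q.entry_mem d).2⟩) <| by
    refine (Fintype.bijective_iff_injective_and_card _).2 ⟨fun d e h => Q.injective ?_, ?_⟩
    · exact Nat.sub_one_cancel (Q.entry_mem d).1 (Q.entry_mem e).1 (congrArg Fin.val h)
    · rw [Fintype.card_coe, Fintype.card_fin, size]

theorem dominoEquiv_add_one (d : {d // d ∈ Q.dominoes}) : (Q.dominoEquiv d : ℕ) + 1 = Q.entry d :=
  Nat.sub_add_cancel (Q.entry_mem d).1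

theorem des_subset : Q.des ⊆ Finset.range Q.size := by
  classical
  exact Finset.filter_subset _ _

theorem mem_des {i : ℕ} : i ∈ Q.des ↔ i < Q.size ∧ Q.IsDescent i := by
  classical
  rw [des, Finset.mem_filter, Finset.mem_range]

theorem row_weak (d e : {d // d ∈ Q.dominoes}) (h : LeftInRow d.1 e.1) :
    Q.entry d ≤ Q.entry e := by
  rcases eq_or_ne d e with rfl | hne
  exacts [le_rfl, (Q.row_strict d e hne h).le]

theorem column_weak (d e : {d // d ∈ Q.dominoes}) (h : AboveInColumn d.1 e.1) :
    Q.entry d ≤ Q.entry e := by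
  rcases eq_or_ne d e with rfl | hne
  exacts [le_rfl, (Q.column_strict d e hne h).le]

variable {Q} {d e : {d // d ∈ Q.dominoes}}

theorem entry_le {c c' : ℕ × ℕ} (hc : c ∈ d.1) (hc' : c' ∈ e.1) (hle : c ≤ c')
    (hup : c.1 ≤ c.2) : Q.entry d ≤ Q.entry e :=
  Q.isUpperPart.entry_le Q.row_weak Q.column_weak hc hc' hle hup

theorem entry_mem_des_iff (h : Q.entry e = Q.entry d + 1) :
    Q.entry d ∈ Q.des ↔ StrictlyLower e.1 d.1 := by
  have hd := Q.entry_mem d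
  have he := Q.entry_mem e
  rw [mem_des]
  constructor
  · rintro ⟨-, ⟨h0, -⟩ | ⟨-, x, y, hx, hy, hxy⟩⟩
    · exact absurd hd.1 (h0 ▸ Nat.not_succ_le_zero 0)
    · rwa [Q.injective hx, Q.injective (hy.trans h.symm)] at hxy
  · exact fun hlow => ⟨h.symm.trans_le he.2, Or.inr ⟨hd.1, d, e, rfl, h, hlow⟩⟩

theorem zero_mem_des_iff (h : Q.entry d = 1) : 0 ∈ Q.des ↔ IsVertical d.1 := by
  rw [mem_des]
  constructor
  · rintro ⟨-, ⟨-, x, hx, hvert⟩ | ⟨h0, -⟩⟩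
    · rwa [Q.injective (hx.trans h.symm)] at hvert
    · exact absurd h0 (lt_irrefl 0)
  · exact fun hvert => ⟨h.symm.trans_le (Q.entry_mem d).2, Or.inl ⟨rfl, d, h, hvert⟩⟩

theorem entry_eq_one_of_origin_mem (h : (0, 0) ∈ d.1) : Q.entry d = 1 := by
  have hd := Q.entry_mem d
  obtain ⟨f, hf⟩ := Q.exists_entry_eq ⟨le_rfl, hd.1.trans hd.2⟩
  obtain ⟨c, hc⟩ := (Q.isUpperPart.isDomino f.2).nonempty
  have hle := entry_le h hc (Prod.mk_le_mk.2 ⟨Nat.zero_le c.1, Nat.zero_le c.2⟩) le_rfl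
  exact le_antisymm (hf ▸ hle) hd.1

theorem origin_mem_of_entry_eq_one (h : Q.entry d = 1) : (0, 0) ∈ d.1 := by
  obtain ⟨c, hc⟩ := (Q.isUpperPart.isDomino d.2).nonempty
  obtain ⟨g, hg⟩ := Q.isUpperPart.exists_mem_of_le d hc
    (Prod.mk_le_mk.2 ⟨Nat.zero_le c.1, Nat.zero_le c.2⟩) le_rfl
  rwa [Q.injective (h.trans (entry_eq_one_of_origin_mem hg).symm)]

/-- If the dominoes share a column, then the next one is not above and hence lower. If it were to
the left, then its top cell would be weakly northwest of a cell of `d`. -/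
theorem precedes_of_entry_eq_add_one (h : Q.entry e = Q.entry d + 1) :
    Precedes (decide (Q.entry d ∈ Q.des)) d.1 e.1 := by
  have hd := Q.isUpperPart.isDomino d.2
  have he := Q.isUpperPart.isDomino e.2
  have hne : d ≠ e := fun hde => Nat.succ_ne_self _ (hde ▸ h).symm
  by_cases hdes : Q.entry d ∈ Q.des
  · rw [decide_eq_true hdes]
    exact (entry_mem_des_iff h).1 hdes
  rw [decide_eq_false hdes]
  rw [entry_mem_des_iff h] at hdes
  by_cases hcol : ShareColumn d.1 e.1
  · have hrow := not_shareRow_of_shareColumn hd he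
      (Q.isUpperPart.disjoint d.2 e.2 (Subtype.coe_ne_coe.2 hne)) hcol
    rcases precedes_or_precedes (b := true) hd he
      fun c hc c' hc' heq => hrow ⟨c, hc, c', hc', heq⟩ with habove | hbelow
    · exact absurd habove hdes
    · obtain ⟨c, hc, c', hc', heq⟩ := hcol
      have := Q.column_strict e d hne.symm ⟨c', hc', c, hc, heq.symm, hbelow c' hc' c hc⟩
      omega
  · refine (precedes_or_precedes (b := false) hd he
      fun c hc c' hc' heq => hcol ⟨c, hc, c', hc', heq⟩).resolve_right fun hleft => hdes ?_
    obtain ⟨z, hz, hup, htop⟩ := (Q.isUpperPart.weaklyAboveDiagonal e.2).exists_top he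
    by_contra hlow
    obtain ⟨c, hc, c', hc', hle⟩ : ∃ c ∈ d.1, ∃ c' ∈ e.1, c'.1 ≤ c.1 := by
      simpa only [StrictlyLower, not_forall, not_lt, exists_prop] using hlow
    have := entry_le hz hc ⟨(htop c' hc').trans hle, (hleft z hz c hc).le⟩ hup
    omega

/-- The letter that an enriched sequence assigns to a domino of `Q`. -/
noncomputable def letter (a : EnrichedSeq Q.size Q.des) (d : {d // d ∈ Q.dominoes}) : Letter :=
  a.1 (Q.dominoEquiv d).succ

variable {a : EnrichedSeq Q.size Q.des}

theorem letter_mono (h : Q.entry d ≤ Q.entry e) : letter a d ≤ letter a e := by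
  rw [← dominoEquiv_add_one, ← dominoEquiv_add_one] at h
  exact a.monotone h

theorem precedes_of_letter_eq_of_entry_eq_add_one (h : Q.entry e = Q.entry d + 1)
    (hlet : letter a d = letter a e) : Precedes (letter a d).isPrimed d.1 e.1 := by
  have he : (Q.dominoEquiv e : ℕ) = Q.entry d :=
    Nat.succ_injective ((Q.dominoEquiv_add_one e).trans h)
  have hd : (Q.dominoEquiv e).castSucc = (Q.dominoEquiv d).succ :=
    Fin.ext (he.trans (Q.dominoEquiv_add_one d).symm)
  have primed_iff := (a.2.2 (Q.dominoEquiv e)).2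
  rw [hd, he] at primed_iff
  convert precedes_of_entry_eq_add_one h
  rw [Bool.eq_iff_iff, decide_eq_true_iff]
  exact primed_iff hlet

theorem precedes_of_letter_eq (hlt : Q.entry d < Q.entry e) (hlet : letter a d = letter a e) :
    Precedes (letter a d).isPrimed d.1 e.1 := by
  obtain ⟨n, hn⟩ := Nat.exists_eq_add_of_lt hlt
  induction n generalizing e with
  | zero => exact precedes_of_letter_eq_of_entry_eq_add_one hn hlet
  | succ n ih =>
    obtain ⟨f, hf⟩ := Q.exists_entry_eq (k := Q.entry d + n + 1)
      ⟨Nat.le_add_left _ _, by have := (Q.entry_mem e).2; omega⟩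
    have hfe : Q.entry e = Q.entry f + 1 := by omega
    have hdf : letter a d = letter a f :=
      le_antisymm (letter_mono (by omega)) (hlet ▸ letter_mono (by omega))
    have step := precedes_of_letter_eq_of_entry_eq_add_one hfe (hdf.symm.trans hlet)
    rw [← hdf] at step
    exact (ih (by omega) hdf hf).trans (Q.isUpperPart.isDomino f.2).nonempty step

theorem eq_of_letter_eq_of_coord_eq (hlet : letter a d = letter a e) {c c' : ℕ × ℕ}
    (hc : c ∈ d.1) (hc' : c' ∈ e.1)
    (h : coord (letter a d).isPrimed c = coord (letter a d).isPrimed c') : d = e := by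
  rcases lt_trichotomy (Q.entry d) (Q.entry e) with hlt | heq | hgt
  · exact absurd h (precedes_of_letter_eq hlt hlet c hc c' hc').ne
  · exact Q.injective heq
  · exact absurd h.symm (hlet ▸ precedes_of_letter_eq hgt hlet.symm c' hc' c hc).ne

theorem isHorizontal_of_letter_eq_zero (h : (0, 0) ∈ d.1) (hlet : letter a d = Letter.unprimed 0) :
    IsHorizontal d.1 := by
  have hone := entry_eq_one_of_origin_mem h
  have hzero : (Q.dominoEquiv d : ℕ) = 0 :=
    Nat.succ_injective ((Q.dominoEquiv_add_one d).trans hone)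
  have primed_iff := (a.2.2 (Q.dominoEquiv d)).2
  rw [show (Q.dominoEquiv d).castSucc = 0 from Fin.ext hzero, a.2.1, hzero, zero_mem_des_iff hone]
    at primed_iff
  exact (Q.isUpperPart.isDomino d.2).resolve_right fun hvert =>
    Bool.false_ne_true ((primed_iff hlet.symm).2 hvert)

/-- The semistandard tableau obtained by replacing the entries of `Q` by the letters of an
enriched sequence for its descent set. -/
noncomputable def withLetters (Q : SShDT lam) (a : EnrichedSeq Q.size Q.des) : SSShDT lam where
  dominoes := Q.dominoes
  isUpperPart := Q.isUpperPart
  entry := letter a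
  row_weak d e h := letter_mono (Q.row_weak d e h)
  column_weak d e h := letter_mono (Q.column_weak d e h)
  row_primed k d e := fun ⟨c, hc, c', hc', heq⟩ hd he =>
    eq_of_letter_eq_of_coord_eq (hd.trans he.symm) hc hc' (by rw [hd]; exact heq)
  column_unprimed k d e := fun ⟨c, hc, c', hc', heq⟩ hd he =>
    eq_of_letter_eq_of_coord_eq (hd.trans he.symm) hc hc' (by rw [hd]; exact heq)
  northwest_zero _ := isHorizontal_of_letter_eq_zero

theorem wt_withLetters (a : EnrichedSeq Q.size Q.des) : (Q.withLetters a).wt = a.wt :=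
  Equiv.sum_comp Q.dominoEquiv fun j => Finsupp.single (a.1 j.succ).abs 1

theorem sortKey_letter_lt_iff (d e : {d // d ∈ Q.dominoes}) :
    sortKey (letter a d) d.1 < sortKey (letter a e) e.1 ↔ Q.entry d < Q.entry e := by
  have lt_of_lt {d e : {d // d ∈ Q.dominoes}} (hlt : Q.entry d < Q.entry e) :
      sortKey (letter a d) d.1 < sortKey (letter a e) e.1 :=
    sortKey_lt_iff.2 <| (letter_mono hlt.le).lt_or_eq.imp_right fun heq =>
      ⟨heq, (precedes_of_letter_eq hlt heq).sup_lt (Q.isUpperPart.isDomino d.2).nonempty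
        (Q.isUpperPart.isDomino e.2).nonempty⟩
  refine ⟨fun hkey => ?_, lt_of_lt⟩
  rcases lt_trichotomy (Q.entry d) (Q.entry e) with hlt | heq | hgt
  · exact hlt
  · exact absurd hkey (Q.injective heq ▸ lt_irrefl _)
  · exact absurd hkey (lt_of_lt hgt).asymm

end SShDT

/-! ### Standardization -/

namespace SSShDT

variable {lam : YoungDiagram} {T : SSShDT lam} {d e : {d // d ∈ T.dominoes}}

theorem eq_of_entry_eq_of_coord_eq (hent : T.entry d = T.entry e) {c c' : ℕ × ℕ}
    (hc : c ∈ d.1) (hc' : c' ∈ e.1)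
    (h : coord (T.entry d).isPrimed c = coord (T.entry d).isPrimed c') : d = e := by
  cases hx : T.entry d with
  | unprimed k =>
    rw [hx] at h
    exact T.column_unprimed k d e ⟨c, hc, c', hc', h⟩ hx (hent.symm.trans hx)
  | primed k =>
    rw [hx] at h
    exact T.row_primed k d e ⟨c, hc, c', hc', h⟩ hx (hent.symm.trans hx)

theorem precedes_or_precedes_of_entry_eq (hne : d ≠ e) (hent : T.entry d = T.entry e) :
    Precedes (T.entry d).isPrimed d.1 e.1 ∨ Precedes (T.entry d).isPrimed e.1 d.1 :=
  precedes_or_precedes (T.isUpperPart.isDomino d.2) (T.isUpperPart.isDomino e.2)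
    fun _ hc _ hc' h => hne (eq_of_entry_eq_of_coord_eq hent hc hc' h)

/-- The sorting key of a domino of `T`. -/
def key (T : SSShDT lam) (d : {d // d ∈ T.dominoes}) : Letter ×ₗ ℕ := sortKey (T.entry d) d.1

theorem key_lt_iff :
    T.key d < T.key e ↔
      T.entry d < T.entry e ∨ T.entry d = T.entry e ∧ Precedes (T.entry d).isPrimed d.1 e.1 := by
  have hd := T.isUpperPart.isDomino d.2
  have he := T.isUpperPart.isDomino e.2
  refine sortKey_lt_iff.trans (or_congr_right (and_congr_right fun hent => ?_))
  refine ⟨fun hlt => ?_, fun h => h.sup_lt hd.nonempty he.nonempty⟩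
  refine precedes_of_sup_lt hd he (fun c hc c' hc' h => ?_) hlt
  exact hlt.ne (eq_of_entry_eq_of_coord_eq hent hc hc' h ▸ rfl)

theorem key_injective : Function.Injective T.key := by
  intro d e h
  by_contra hne
  have hent : T.entry d = T.entry e := congrArg Prod.fst (toLex.injective h)
  rcases precedes_or_precedes_of_entry_eq hne hent with hde | hed
  · exact (key_lt_iff.2 (Or.inr ⟨hent, hde⟩)).ne h
  · exact (key_lt_iff.2 (Or.inr ⟨hent.symm, hent ▸ hed⟩)).ne h.symm

theorem key_lt_of_le (hne : d ≠ e) (hent : T.entry d ≤ T.entry e) {c c' : ℕ × ℕ} (hc : c ∈ d.1)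
    (hc' : c' ∈ e.1) (hle : c ≤ c') : T.key d < T.key e := by
  refine key_lt_iff.2 (hent.lt_or_eq.imp_right fun heq => ⟨heq, ?_⟩)
  exact (precedes_or_precedes_of_entry_eq hne heq).resolve_right fun h =>
    (h c' hc' c hc).not_ge (coord_mono _ hle)

/-- The ranking of the dominoes by their sorting keys. -/
noncomputable def rank (T : SSShDT lam) : {d // d ∈ T.dominoes} → ℕ :=
  (existsUnique_ranking T.key_injective).choose

theorem range_rank : Set.range T.rank = Set.Icc 1 T.dominoes.card := by
  rw [← Fintype.card_coe]
  exact (existsUnique_ranking T.key_injective).choose_spec.1.1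

theorem rank_lt_iff : T.rank d < T.rank e ↔ T.key d < T.key e :=
  (existsUnique_ranking T.key_injective).choose_spec.1.2 d e

theorem rank_injective : Function.Injective T.rank := fun _ _ h =>
  key_injective (le_antisymm (not_lt.1 (mt rank_lt_iff.2 h.not_gt))
    (not_lt.1 (mt rank_lt_iff.2 h.not_lt)))

theorem eq_rank {q : {d // d ∈ T.dominoes} → ℕ} (hrange : Set.range q = Set.Icc 1 T.dominoes.card)
    (hlt : ∀ d e, q d < q e ↔ T.key d < T.key e) : q = T.rank :=
  (existsUnique_ranking T.key_injective).unique ⟨by rwa [Fintype.card_coe], hlt⟩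
    ⟨by rw [Fintype.card_coe, range_rank], fun _ _ => rank_lt_iff⟩

/-- The standard tableau whose entries rank the dominoes of `T` by their sorting keys. -/
noncomputable def standardize (T : SSShDT lam) : SShDT lam where
  dominoes := T.dominoes
  isUpperPart := T.isUpperPart
  entry := T.rank
  injective := rank_injective
  range_eq := range_rank
  row_strict d e hne h := by
    obtain ⟨c, hc, c', hc', hrow, hlt⟩ := id h
    exact rank_lt_iff.2 (key_lt_of_le hne (T.row_weak d e h) hc hc' ⟨hrow.le, hlt.le⟩)
  column_strict d e hne h := by
    obtain ⟨c, hc, c', hc', hcol, hlt⟩ := id h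
    exact rank_lt_iff.2 (key_lt_of_le hne (T.column_weak d e h) hc hc' ⟨hlt.le, hcol.le⟩)

/-- Otherwise the corner in the row of a cell of `d` and the column of a cell of `e` would belong
to a domino with the same entry `k`, and the column of that corner would contain two entries
`k`. -/
theorem not_strictlyLower_of_precedes {k : ℕ} (hd : T.entry d = Letter.unprimed k)
    (he : T.entry e = Letter.unprimed k) (h : Precedes false d.1 e.1) :
    ¬ StrictlyLower e.1 d.1 := by
  intro hlow
  obtain ⟨⟨r, j⟩, hz, hup : r ≤ j⟩ := T.isUpperPart.weaklyAboveDiagonal d.2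
  obtain ⟨⟨r', j'⟩, hy⟩ := (T.isUpperPart.isDomino e.2).nonempty
  have hr : r < r' := hlow _ hz _ hy
  have hj : j < j' := h _ hz _ hy
  obtain ⟨g, hg⟩ := T.isUpperPart.exists_mem_of_le e (c := (r, j')) hy ⟨hr.le, le_rfl⟩
    (hup.trans hj.le)
  have hdg : T.entry d ≤ T.entry g := T.row_weak d g ⟨_, hz, _, hg, rfl, hj⟩
  have hge : T.entry g ≤ T.entry e := T.column_weak g e ⟨_, hg, _, hy, rfl, hr⟩
  have hgk : T.entry g = Letter.unprimed k := le_antisymm (he ▸ hge) (hd ▸ hdg)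
  obtain rfl : g = e := T.column_unprimed k g e ⟨_, hg, _, hy, rfl⟩ hgk he
  exact lt_irrefl r (hlow _ hz _ hg)

theorem mem_des_standardize_iff (h : T.rank e = T.rank d + 1) (hent : T.entry d = T.entry e) :
    (T.entry d).isPrimed = true ↔ T.rank d ∈ T.standardize.des := by
  have hprec : Precedes (T.entry d).isPrimed d.1 e.1 := by
    have hkey : T.key d < T.key e := rank_lt_iff.1 (h ▸ Nat.lt_succ_self _)
    exact ((key_lt_iff.1 hkey).resolve_left hent.not_lt).2
  refine Iff.trans ?_ (SShDT.entry_mem_des_iff (Q := T.standardize) h).symm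
  cases hx : T.entry d with
  | unprimed k =>
    rw [hx] at hprec
    exact iff_of_false Bool.false_ne_true
      (not_strictlyLower_of_precedes hx (hent.symm.trans hx) hprec)
  | primed k =>
    rw [hx] at hprec
    exact iff_of_true rfl hprec

theorem zero_notMem_des_standardize (h : T.rank d = 1) (hent : T.entry d = Letter.unprimed 0) :
    0 ∉ T.standardize.des := by
  rw [SShDT.zero_mem_des_iff (Q := T.standardize) h]
  have horigin := SShDT.origin_mem_of_entry_eq_one (Q := T.standardize) h
  exact fun hvert => not_isHorizontal_and_isVertical ⟨T.northwest_zero d horigin hent, hvert⟩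

theorem entry_le_of_rank_lt (h : T.rank d < T.rank e) : T.entry d ≤ T.entry e :=
  (key_lt_iff.1 (rank_lt_iff.1 h)).elim le_of_lt fun h => h.1.le

/-- The entries of `T` in the order of its standardization, preceded by `0`. -/
noncomputable def entrySeq (T : SSShDT lam) : Fin (T.standardize.size + 1) → Letter :=
  Fin.cons (Letter.unprimed 0) fun j => T.entry (T.standardize.dominoEquiv.symm j)

theorem entrySeq_succ_dominoEquiv (d : {d // d ∈ T.standardize.dominoes}) :
    T.entrySeq (T.standardize.dominoEquiv d).succ = T.entry d :=
  congrArg T.entry (T.standardize.dominoEquiv.symm_apply_apply d)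

theorem entrySeq_step (j : Fin T.standardize.size) :
    T.entrySeq j.castSucc ≤ T.entrySeq j.succ ∧ (T.entrySeq j.castSucc = T.entrySeq j.succ →
      ((T.entrySeq j.castSucc).isPrimed = true ↔ (j : ℕ) ∈ T.standardize.des)) := by
  obtain ⟨e, rfl⟩ := T.standardize.dominoEquiv.surjective j
  have he : T.rank e = T.standardize.dominoEquiv e + 1 :=
    (T.standardize.dominoEquiv_add_one e).symm
  rw [entrySeq_succ_dominoEquiv]
  rcases Nat.eq_zero_or_pos (T.standardize.dominoEquiv e : ℕ) with hzero | hpos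
  · rw [show (T.standardize.dominoEquiv e).castSucc = 0 from Fin.ext hzero, hzero]
    refine ⟨Letter.unprimed_zero_le _, fun hent => iff_of_false Bool.false_ne_true ?_⟩
    exact zero_notMem_des_standardize (by rw [he, hzero]) hent.symm
  · obtain ⟨d, hd : T.rank d = _⟩ :=
      T.standardize.exists_entry_eq ⟨hpos, (T.standardize.dominoEquiv e).2.le⟩
    have hde : (T.standardize.dominoEquiv e).castSucc = (T.standardize.dominoEquiv d).succ :=
      Fin.ext (hd.symm.trans (T.standardize.dominoEquiv_add_one d).symm)
    rw [← hd] at he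
    rw [hde, entrySeq_succ_dominoEquiv, ← hd]
    exact ⟨entry_le_of_rank_lt (he ▸ Nat.lt_succ_self _), mem_des_standardize_iff he⟩

/-- The enriched sequence formed by the entries of `T`. -/
noncomputable def enrichedSeq (T : SSShDT lam) :
    EnrichedSeq T.standardize.size T.standardize.des :=
  ⟨T.entrySeq, rfl, entrySeq_step⟩

theorem withLetters_standardize (T : SSShDT lam) : T.standardize.withLetters T.enrichedSeq = T := by
  have hentry : SShDT.letter T.enrichedSeq = T.entry := by
    funext d
    exact entrySeq_succ_dominoEquiv d
  obtain ⟨s, hs, f, h1, h2, h3, h4, h5⟩ := T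
  rw [SShDT.withLetters, SSShDT.mk.injEq]
  exact ⟨rfl, heq_of_eq hentry⟩

end SSShDT

namespace SShDT

variable {lam : YoungDiagram} (Q : SShDT lam)

theorem standardize_withLetters (a : EnrichedSeq Q.size Q.des) :
    (Q.withLetters a).standardize = Q := by
  have hentry : Q.entry = (Q.withLetters a).rank :=
    SSShDT.eq_rank (T := Q.withLetters a) Q.range_eq fun d e => (sortKey_letter_lt_iff d e).symm
  obtain ⟨s, hs, q, h1, h2, h3, h4⟩ := Q
  rw [SSShDT.standardize, mk.injEq]
  exact ⟨rfl, heq_of_eq hentry.symm⟩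

theorem withLetters_injective : Function.Injective Q.withLetters := by
  intro a b h
  have hletter : letter a = letter b := by
    rw [withLetters, withLetters, SSShDT.mk.injEq] at h
    exact eq_of_heq h.2
  refine Subtype.ext (funext (Fin.cases (a.2.1.trans b.2.1.symm) fun j => ?_))
  obtain ⟨d, rfl⟩ := Q.dominoEquiv.surjective j
  exact congrFun hletter d

theorem finite_enrichedSeq_wt_eq (e : ℕ →₀ ℕ) :
    Finite {a : EnrichedSeq Q.size Q.des // a.wt = e} := by
  have := SSShDT.finite_wt_eq lam e
  exact Finite.of_injective
    (fun a => (⟨Q.withLetters a.1, (wt_withLetters a.1).trans a.2⟩ : {T : SSShDT lam // T.wt = e}))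
    fun a b h => Subtype.ext (Q.withLetters_injective (congrArg Subtype.val h))

end SShDT

/-- A semistandard tableau is a standard tableau together with an enriched sequence for its
descent set. -/
noncomputable def standardizationEquiv (lam : YoungDiagram) :
    (Σ Q : SShDT lam, EnrichedSeq Q.size Q.des) ≃ SSShDT lam := by
  refine Equiv.ofBijective (fun p => p.1.withLetters p.2)
    ⟨?_, fun T => ⟨⟨T.standardize, T.enrichedSeq⟩, T.withLetters_standardize⟩⟩
  rintro ⟨Q, a⟩ ⟨Q', a'⟩ h
  obtain rfl : Q = Q' := by
    rw [← Q.standardize_withLetters a, ← Q'.standardize_withLetters a']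
    exact congrArg SSShDT.standardize h
  exact congrArg (Sigma.mk Q) (Q.withLetters_injective h)

end ShiftedDomino

theorem mainTheorem4_general (lam : YoungDiagram) :
    ShiftedDomino.shiftedDominoFun lam =
      ∑ Q : ShiftedDomino.SShDT lam, ShiftedDomino.deltaB Q.size Q.des := by
  open ShiftedDomino in
  calc shiftedDominoFun lam
    _ = genFun fun p : Σ Q : SShDT lam, EnrichedSeq Q.size Q.des => p.2.wt :=
        (genFun_congr (standardizationEquiv lam) fun p => SShDT.wt_withLetters p.2)
    _ = ∑ Q : SShDT lam, genFun (EnrichedSeq.wt : EnrichedSeq Q.size Q.des → ℕ →₀ ℕ) :=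
        genFun_sigma _ SShDT.finite_enrichedSeq_wt_eq
    _ = ∑ Q : SShDT lam, deltaB Q.size Q.des :=
        Finset.sum_congr rfl fun Q _ => (deltaB_eq_genFun Q.des_subset).symm

theorem mainTheorem4 (lam : YoungDiagram) (hlam : ShiftedDomino.QuotientCondition lam) :
    ShiftedDomino.shiftedDominoFun lam =
      ∑ Q : ShiftedDomino.SShDT lam, ShiftedDomino.deltaB Q.size Q.des :=
  mainTheorem4_general lam
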